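/- For a finite group $G$ and an integer $a$ coprime to $|G|$, let $\rho_a$ be the permutation $g\mapsto g^a$ of the elements of $G$, and let $\operatorname{sgn}(\rho_a)\in\{1,-1\}$ be its signature. Let $f_2(G)=\{g\in G: g^2=1\}$, let $n_2(G)$ be the number of Sylow $2$-subgroups of $G$, let $\epsilon(G)=1$ if $|G|=2n_2(G)$ and $\epsilon(G)=0$ otherwise, and put $$d_G=(-1)^{\frac{|G|-|f_2(G)|}{2}}\,\frac{|G|^{|f_2(G)|}}{n_2(G)^{\epsilon(G)}}\in\mathbb Z .$$ Let $G$ be a finite group of order $2n$ with $n$ odd, in which every element of even order has order $2$. Then $$\operatorname{sgn}(\rho_a)=\left(\frac{d_G}{a}\right)$$ for every integer $a$ (positive or negative) with $\gcd(a,|G|)=1$, where $\left(\frac{\cdot}{\cdot}\right)$ is the Kronecker symbol. Moreover, $G$ has exactly one subgroup $H$ of index $2$; it has odd order $n$, and for every such $a$ the signature of $g\mapsto g^a$ on $G$ equals the signature of $h\mapsto h^a$ on $H$. -/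

import Mathlib

/-- The Kronecker symbol `(n / a)` of two integers. For `a ≠ 0` it is the product of
`(n / -1)` (only if `a < 0`), of `(n / 2) ^ v₂(a)`, and of the Jacobi symbol of `n` modulo the odd
part of `|a|`. Here `(n / -1)` is `-1` if `n < 0` and `1` otherwise, and `(n / 2)` is `0` for even
`n`, `1` for `n ≡ ±1 (mod 8)`, `-1` for `n ≡ ±3 (mod 8)`. -/
def kroneckerSym (n a : ℤ) : ℤ :=
  if a = 0 then (if n = 1 then 1 else 0)
  else (if a < 0 ∧ n < 0 then -1 else 1) *
    ZMod.χ₈ (n : ZMod 8) ^ padicValNat 2 a.natAbs *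
    jacobiSym n (a.natAbs / 2 ^ padicValNat 2 a.natAbs)

theorem zpow_bijective_of_isCoprime_card {G : Type*} [Group G] {a : ℤ}
    (h : IsCoprime a (Nat.card G : ℤ)) : Function.Bijective (fun g : G => g ^ a) := by
  obtain ⟨u, v, huv⟩ := h
  have key : ∀ g : G, g ^ (u * a) = g := fun g => by
    have h1 : g ^ (u * a + v * (Nat.card G : ℤ)) = g := by rw [huv, zpow_one]
    rwa [zpow_add, mul_comm v, zpow_mul g (Nat.card G : ℤ) v, zpow_natCast, pow_card_eq_one',
      one_zpow, mul_one] at h1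
  refine ⟨fun x y hxy => ?_, fun y => ⟨y ^ u, ?_⟩⟩
  · have hxy' : x ^ a = y ^ a := hxy
    rw [← key x, ← key y, mul_comm, zpow_mul, zpow_mul, hxy']
  · change (y ^ u) ^ a = y
    rw [← zpow_mul, key]

theorem IsCoprime.card_subgroup {G : Type*} [Group G] {a : ℤ}
    (h : IsCoprime a (Nat.card G : ℤ)) (H : Subgroup G) : IsCoprime a (Nat.card H : ℤ) :=
  h.of_isCoprime_of_dvd_right (Int.natCast_dvd_natCast.mpr H.card_subgroup_dvd_card)

/-- The permutation `ρ_a : g ↦ g ^ a` of the elements of `G`, for `a` coprime to `|G|`. -/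
noncomputable def powerPerm (G : Type*) [Group G] (a : ℤ)
    (h : IsCoprime a (Nat.card G : ℤ)) : Equiv.Perm G :=
  Equiv.ofBijective (fun g : G => g ^ a) (zpow_bijective_of_isCoprime_card h)

open Classical in
/-- The signature of the permutation `ρ_a` of the elements of the finite group `G`. -/
noncomputable def elSign (G : Type*) [Group G] [Finite G] (a : ℤ)
    (h : IsCoprime a (Nat.card G : ℤ)) : ℤˣ :=
  letI := Fintype.ofFinite G
  Equiv.Perm.sign (powerPerm G a h)

/-- `f_m(G) = {g ∈ G : g ^ m = 1}`. -/
def powEqOne (G : Type*) [Group G] (m : ℕ) : Set G := {g : G | g ^ m = 1}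

/-- The number `n₂(G)` of Sylow `2`-subgroups of `G`. -/
noncomputable def numSylowTwo (G : Type*) [Group G] : ℕ := Nat.card (Sylow 2 G)

/-- `ε(G)`, equal to `1` if `|G| = 2 n₂(G)` and to `0` otherwise. -/
noncomputable def epsG (G : Type*) [Group G] : ℕ :=
  if Nat.card G = 2 * numSylowTwo G then 1 else 0

/-- The integer `d_G = (-1) ^ ((|G| - |f₂(G)|) / 2) * |G| ^ |f₂(G)| / n₂(G) ^ ε(G)` of a finite
group `G`. The subtraction and both divisions are exact: elements outside `f₂(G)` come in pairs
`{g, g⁻¹}`, the identity lies in `f₂(G)`, and `n₂(G)` divides `|G|`. -/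
noncomputable def dG (G : Type*) [Group G] : ℤ :=
  (-1) ^ ((Nat.card G - (powEqOne G 2).ncard) / 2) *
    ((Nat.card G ^ (powEqOne G 2).ncard / numSylowTwo G ^ epsG G : ℕ) : ℤ)

/-! Since `|G| = 2n` with `n` odd, `G` has a unique subgroup `H` of index 2. Elements outside `H`
have even order, hence are involutions, and odd powers fix them: the signature only sees `H`
(`elSign_eq_of_index_two`). An involution outside `H` inverts `H` by conjugation, so `H` is abelian.

On an abelian group of odd order `n` the signature is the Jacobi symbol `(a / n)`
(`elSign_of_odd_comm`): it is multiplicative along extensions, which reduces the claim to prime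
order, i.e. to Zolotarev's lemma.

Counting involutions and Sylow subgroups shows that `d_G` is `(-1) ^ ((n - 1) / 2) * n` times a
square prime to `a` (`dG_eq`), and quadratic reciprocity turns `(a / n)` into `(d_G / a)`. -/

/-! ### Signatures of power maps on abelian groups of odd order -/

theorem elSign_eq_sign_of_equiv {G α : Type*} [Group G] [Finite G] [Fintype α] [DecidableEq α]
    {a : ℤ} (ha : IsCoprime a (Nat.card G : ℤ)) (e : G ≃ α) (σ : Equiv.Perm α)
    (h : ∀ g, e (g ^ a) = σ (e g)) : elSign G a ha = Equiv.Perm.sign σ := by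
  classical
  let := Fintype.ofFinite G
  exact Equiv.Perm.sign_eq_sign_of_equiv _ _ e h

theorem Int.units_pow_of_odd (u : ℤˣ) {n : ℕ} (hn : Odd n) : u ^ n = u := by
  obtain ⟨k, rfl⟩ := hn
  rw [pow_succ, pow_mul, Int.units_sq, one_pow, one_mul]

theorem Equiv.Perm.sign_mulLeft_of_odd_card {K : Type*} [Group K] [Fintype K] [DecidableEq K]
    (hK : Odd (Nat.card K)) (c : K) : Equiv.Perm.sign (Equiv.mulLeft c) = 1 := by
  rw [← Int.units_pow_of_odd (Equiv.Perm.sign (Equiv.mulLeft c)) hK, ← map_pow,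
    Equiv.pow_mulLeft, pow_card_eq_one', Equiv.mulLeft_one, Equiv.Perm.sign_one]

/-- Multiplicativity of the signature of `g ↦ g ^ a` along `1 → K → H → H ⧸ K → 1`. -/
theorem elSign_eq_mul_quotient {H : Type*} [CommGroup H] [Finite H] (hH : Odd (Nat.card H))
    (K : Subgroup H) {a : ℤ} (ha : IsCoprime a (Nat.card H : ℤ))
    (hK : IsCoprime a (Nat.card K : ℤ)) (hQ : IsCoprime a (Nat.card (H ⧸ K) : ℤ)) :
    elSign H a ha = elSign K a hK * elSign (H ⧸ K) a hQ := by
  classical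
  let := Fintype.ofFinite K
  let := Fintype.ofFinite (H ⧸ K)
  have hcard := K.card_eq_card_quotient_mul_card_subgroup
  rw [hcard, Nat.odd_mul] at hH
  let e : H ≃ (H ⧸ K) × K :=
    { toFun := fun h => ((h : H ⧸ K), ⟨(h : H ⧸ K).out⁻¹ * h, QuotientGroup.eq.1 (by simp)⟩)
      invFun := fun x => x.1.out * x.2
      left_inv := fun h => by simp
      right_inv := fun x => by
        have h1 : ((x.1.out * (x.2 : H) : H) : H ⧸ K) = x.1 := by
          rw [QuotientGroup.mk_mul_of_mem _ x.2.2, QuotientGroup.out_eq']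
        refine Prod.ext h1 (Subtype.ext ?_)
        simp [h1] }
  -- The section `out` need not commute with `a`-th powers; `c` measures the defect. In the
  -- coordinates `e` the power map is `(q, k) ↦ (q ^ a, c q * k ^ a)`, and translation by `c q` is
  -- even because `|K|` is odd.
  let c : H ⧸ K → K := fun q => ⟨(q ^ a).out⁻¹ * q.out ^ a, QuotientGroup.eq.1 (by simp)⟩
  let σ : Equiv.Perm ((H ⧸ K) × K) :=
    Equiv.prodCongrLeft (fun _ : K => powerPerm (H ⧸ K) a hQ) *
      Equiv.prodCongrRight (fun q => Equiv.mulLeft (c q) * powerPerm K a hK)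
  have hσ : ∀ h, e (h ^ a) = σ (e h) := fun h => by
    refine Prod.ext rfl (Subtype.ext ?_)
    change ((h ^ a : H) : H ⧸ K).out⁻¹ * h ^ a =
      (((h : H ⧸ K) ^ a).out⁻¹ * (h : H ⧸ K).out ^ a) * ((h : H ⧸ K).out⁻¹ * h) ^ a
    rw [mul_zpow, inv_zpow, QuotientGroup.mk_zpow]
    group
  rw [elSign_eq_sign_of_equiv ha e σ hσ, Equiv.Perm.sign_mul, Equiv.Perm.sign_prodCongrLeft,
    Equiv.Perm.sign_prodCongrRight]
  simp only [Equiv.Perm.sign_mul, Equiv.Perm.sign_mulLeft_of_odd_card hH.2, one_mul,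
    Finset.prod_const, Finset.card_univ, ← Nat.card_eq_fintype_card]
  rw [Int.units_pow_of_odd _ hH.1, Int.units_pow_of_odd _ hH.2, mul_comm,
    elSign_eq_sign_of_equiv hK (Equiv.refl K) (powerPerm K a hK) fun _ => rfl,
    elSign_eq_sign_of_equiv hQ (Equiv.refl (H ⧸ K)) (powerPerm (H ⧸ K) a hQ) fun _ => rfl]

open Classical in
/-- Zolotarev's lemma over a finite field of odd characteristic. -/
theorem sign_units_smul_eq_quadraticChar {F : Type*} [Field F] [Fintype F] (hF : ringChar F ≠ 2)
    (u : Fˣ) : ((Equiv.Perm.sign (MulAction.toPerm u : Equiv.Perm F) : ℤˣ) : ℤ) =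
      quadraticChar F (u : F) := by
  set φ : Fˣ →* ℤˣ := Equiv.Perm.sign.comp (MulAction.toPermHom Fˣ F) with hφ
  change ((φ u : ℤˣ) : ℤ) = _
  obtain ⟨g, hg⟩ := IsCyclic.exists_generator (α := Fˣ)
  have hodd := FiniteField.odd_card_of_char_ne_two hF
  have hg1 : (g : F) ≠ 1 := by
    intro h
    obtain ⟨x, hx⟩ := FiniteField.exists_nonsquare hF
    have hx0 : x ≠ 0 := fun h0 => hx (h0 ▸ ⟨0, by simp⟩)
    obtain ⟨k, hk⟩ := hg (Units.mk0 x hx0)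
    have hg' : g = 1 := Units.ext h
    apply hx
    have := congrArg Units.val hk
    simp only [hg', one_zpow, Units.val_one, Units.val_mk0] at this
    exact ⟨1, by simp [← this]⟩
  -- Both sides are homomorphisms on the cyclic group `Fˣ`, so a generator suffices: it fixes `0`
  -- and permutes the nonzero elements in one cycle, of even length `|F| - 1`.
  have hφg : φ g = -1 := by
    have hcyc : (MulAction.toPerm g : Equiv.Perm F).IsCycle := by
      refine ⟨1, by simpa [Units.smul_def] using hg1, fun y hy => ?_⟩
      have hy0 : y ≠ 0 := by
        rintro rfl
        simp at hy
      obtain ⟨k, hk⟩ := hg (Units.mk0 y hy0)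
      refine ⟨k, ?_⟩
      have h1 : (MulAction.toPerm g : Equiv.Perm F) ^ k = MulAction.toPerm (g ^ k) :=
        (map_zpow (MulAction.toPermHom Fˣ F) g k).symm
      have h2 : g ^ k = Units.mk0 y hy0 := hk
      rw [h1, h2]
      simp [Units.smul_def]
    have hsupp : (MulAction.toPerm g : Equiv.Perm F).support = Finset.univ.erase 0 := by
      ext y
      simp only [Equiv.Perm.mem_support, MulAction.toPerm_apply, Units.smul_def, smul_eq_mul,
        Finset.mem_erase, Finset.mem_univ, and_true, ne_eq]
      constructor
      · rintro h rfl
        simp at h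
      · exact fun h h' => hg1 (mul_right_cancel₀ h (h'.trans (one_mul y).symm))
    have hev : Even (Fintype.card F - 1) := by
      rw [Nat.even_sub' Fintype.card_pos]
      simpa using Nat.odd_iff.2 hodd
    change Equiv.Perm.sign (MulAction.toPerm g : Equiv.Perm F) = -1
    rw [hcyc.sign, hsupp, Finset.card_erase_of_mem (Finset.mem_univ _), Finset.card_univ,
      hev.neg_one_pow]
  -- A square would have sign `1` under `φ`, so `g` is not one.
  have hχg : quadraticChar F (g : F) = -1 := by
    rw [quadraticChar_neg_one_iff_not_isSquare]
    rintro ⟨r, hr⟩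
    have hr0 : r ≠ 0 := by
      rintro rfl
      simp at hr
    have h3 : g = Units.mk0 r hr0 ^ 2 := Units.ext (by simp [hr, sq])
    rw [h3, map_pow, Int.units_sq] at hφg
    exact absurd hφg (by decide)
  obtain ⟨k, rfl⟩ := (Submonoid.mem_powers_iff _ _).1 (mem_powers_iff_mem_zpowers.2 (hg u))
  rw [map_pow, hφg, Units.val_pow_eq_pow_val, Units.val_pow_eq_pow_val, map_pow, hχg]
  simp

theorem elSign_of_card_prime {K : Type*} [Group K] [Finite K] {p : ℕ} [Fact p.Prime] (hp : p ≠ 2)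
    (hK : Nat.card K = p) {a : ℤ} (ha : IsCoprime a (Nat.card K : ℤ)) :
    ((elSign K a ha : ℤˣ) : ℤ) = jacobiSym a p := by
  classical
  have hcyc : IsCyclic K := isCyclic_of_prime_card hK
  subst hK
  set p := Nat.card K
  let e : K ≃ ZMod p := (zmodCyclicMulEquiv hcyc).symm.toEquiv.trans Multiplicative.toAdd
  have ha' : IsUnit (a : ZMod p) := by
    rwa [ZMod.coe_int_isUnit_iff_isCoprime, isCoprime_comm]
  rw [elSign_eq_sign_of_equiv ha e (MulAction.toPerm ha'.unit) fun g => by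
    simp [e, Units.smul_def], ← jacobiSym.legendreSym.to_jacobiSym, legendreSym]
  have := sign_units_smul_eq_quadraticChar (F := ZMod p) (by rwa [ZMod.ringChar_zmod_n]) ha'.unit
  rw [IsUnit.unit_spec] at this
  convert this

/-- The signature of `h ↦ h ^ a` on an abelian group of odd order is a Jacobi symbol. -/
theorem elSign_of_odd_comm {H : Type*} [CommGroup H] [Finite H] (hH : Odd (Nat.card H)) {a : ℤ}
    (ha : IsCoprime a (Nat.card H : ℤ)) :
    ((elSign H a ha : ℤˣ) : ℤ) = jacobiSym a (Nat.card H) := by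
  induction hm : Nat.card H using Nat.strong_induction_on generalizing H with
  | _ m ih =>
  subst hm
  rcases eq_or_ne (Nat.card H) 1 with h1 | h1
  · rw [h1, jacobiSym.one_right]
    have : Subsingleton H := (Nat.card_eq_one_iff_unique.1 h1).1
    let := Fintype.ofFinite H
    rw [elSign_eq_sign_of_equiv ha (Equiv.refl H) 1 fun _ => Subsingleton.elim _ _,
      Equiv.Perm.sign_one, Units.val_one]
  · have hp := Nat.minFac_prime h1
    have hpd := Nat.minFac_dvd (Nat.card H)
    set p := (Nat.card H).minFac
    have := Fact.mk hp
    have hp2 : p ≠ 2 := by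
      intro h
      rw [h] at hpd
      exact (Nat.not_even_iff_odd.2 hH) (even_iff_two_dvd.2 hpd)
    obtain ⟨x, hx⟩ := exists_prime_orderOf_dvd_card' p hpd
    let K := Subgroup.zpowers x
    have hKp : Nat.card K = p := by rw [Nat.card_zpowers, hx]
    have hcard := K.card_eq_card_quotient_mul_card_subgroup
    have hK : IsCoprime a (Nat.card K : ℤ) := ha.card_subgroup K
    have hQ : IsCoprime a (Nat.card (H ⧸ K) : ℤ) :=
      ha.of_isCoprime_of_dvd_right (Int.natCast_dvd_natCast.2 ⟨_, hcard⟩)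
    have hodd : Odd (Nat.card (H ⧸ K)) := (Nat.odd_mul.1 (hcard ▸ hH)).1
    have hlt : Nat.card (H ⧸ K) < Nat.card H := by
      rw [hcard, hKp]
      exact lt_mul_of_one_lt_right Nat.card_pos hp.one_lt
    rw [elSign_eq_mul_quotient hH K ha hK hQ, Units.val_mul, elSign_of_card_prime hp2 hKp hK,
      ih _ hlt hodd hQ rfl, hcard, hKp,
      jacobiSym.mul_right' a Nat.card_pos.ne' hp.ne_zero, mul_comm]

/-! ### Quadratic reciprocity for the Kronecker symbol -/

theorem jacobiSym_eq_neg_one_pow_mul {m n : ℕ} (hm : Odd m) (hn : Odd n) :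
    jacobiSym ((-1) ^ ((n - 1) / 2) * n) m = jacobiSym m n := by
  have hn' : (n - 1) / 2 = n / 2 := by
    obtain ⟨k, rfl⟩ := hn
    omega
  rw [hn', jacobiSym.mul_left, jacobiSym.pow_left, jacobiSym.at_neg_one hm,
    jacobiSym.quadratic_reciprocity hn hm, ZMod.χ₄_eq_neg_one_pow (Nat.odd_iff.1 hm), ← mul_assoc,
    ← pow_mul, mul_comm (m / 2), ← mul_pow]
  simp

/-- Quadratic reciprocity for the Kronecker symbol of `n* = (-1) ^ ((n - 1) / 2) * n` times a
square. -/
theorem kroneckerSym_eq_jacobiSym {n : ℕ} (hn : Odd n) {a d s : ℤ} (ha : IsCoprime a (2 * n))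
    (hs : IsCoprime a s) (hs0 : s ≠ 0) (hd : d = (-1) ^ ((n - 1) / 2) * n * s ^ 2) :
    kroneckerSym d a = jacobiSym a n := by
  have ha2 : Odd a := by
    rw [← Int.not_even_iff_odd, even_iff_two_dvd]
    intro h
    have := (ha.of_mul_right_left).isUnit_of_dvd' h dvd_rfl
    exact absurd this (by decide)
  have ha0 : a ≠ 0 := by
    rintro rfl
    simp at ha2
  have hodd : Odd a.natAbs := Int.natAbs_odd.2 ha2
  have hv : padicValNat 2 a.natAbs = 0 :=
    padicValNat.eq_zero_of_not_dvd (fun h => (Nat.not_even_iff_odd.2 hodd) (even_iff_two_dvd.2 h))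
  have hsq : jacobiSym (s ^ 2) a.natAbs = 1 := jacobiSym.sq_one' (by
    simpa only [Int.gcd, Int.natAbs_natCast] using Int.isCoprime_iff_gcd_eq_one.1 hs.symm)
  have hsign : (d < 0) ↔ Odd ((n - 1) / 2) := by
    have hnpos : (0 : ℤ) < n * s ^ 2 := by
      have := hn.pos
      positivity
    rw [hd, mul_assoc]
    rcases Nat.even_or_odd ((n - 1) / 2) with h | h
    · simp [h.neg_one_pow, hnpos.le, Nat.not_odd_iff_even.2 h]
    · simp only [h.neg_one_pow, h, iff_true]
      linarith
  rw [kroneckerSym, if_neg ha0, hv, pow_zero, pow_zero, mul_one, Nat.div_one]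
  simp only [hsign]
  rw [hd, jacobiSym.mul_left, hsq, mul_one, jacobiSym_eq_neg_one_pow_mul hodd hn]
  -- For negative `a`, the factor `(d / -1)` and the value `(-1 / n)` are both `(-1) ^ ((n - 1) /
  -- 2)`.
  rcases lt_or_ge a 0 with h | h
  · have hneg : a = -(a.natAbs : ℤ) := by omega
    conv_rhs => rw [hneg, jacobiSym.neg _ hn, ZMod.χ₄_eq_neg_one_pow (Nat.odd_iff.1 hn)]
    have hn' : (n - 1) / 2 = n / 2 := by
      obtain ⟨k, rfl⟩ := hn
      omega
    rw [hn']
    rcases Nat.even_or_odd (n / 2) with h' | h'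
    · simp [h'.neg_one_pow, Nat.not_odd_iff_even.2 h']
    · simp [h'.neg_one_pow, h', h]
  · rw [if_neg (by simp [h.not_gt]), one_mul, Int.natAbs_of_nonneg h]

/-! ### The subgroup of index 2 in a group of order `2n`, `n` odd -/

namespace Subgroup

theorem card_of_index_two {G : Type*} [Group G] {n : ℕ} (hcard : Nat.card G = 2 * n)
    {H : Subgroup G} (hH : H.index = 2) :
    Nat.card H = n := by
  have := H.card_mul_index
  rw [hH, hcard] at this
  omega

variable {G : Type*} [Group G] [Finite G] {n : ℕ}

theorem card_sylow_two (hn : Odd n) (hcard : Nat.card G = 2 * n) (P : Sylow 2 G) :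
    Nat.card P = 2 := by
  have hn0 : n ≠ 0 := hn.pos.ne'
  rw [P.card_eq_multiplicity, hcard, Nat.factorization_mul two_ne_zero hn0, Finsupp.add_apply,
    Nat.prime_two.factorization_self, Nat.factorization_eq_zero_of_not_dvd
      (fun h => (Nat.not_even_iff_odd.2 hn) (even_iff_two_dvd.2 h)), add_zero, pow_one]

omit [Finite G] in
theorem mem_iff_pow_eq_one_of_index_two (hn : Odd n) (hcard : Nat.card G = 2 * n)
    {H : Subgroup G} (hH : H.index = 2) (g : G) : g ∈ H ↔ g ^ n = 1 := by
  refine ⟨fun h => ?_, fun h => ?_⟩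
  · rw [← card_of_index_two hcard hH]
    exact congrArg Subtype.val (pow_card_eq_one' (x := (⟨g, h⟩ : H)))
  · obtain ⟨k, rfl⟩ := hn
    have h2 : (g ^ 2) ^ k ∈ H := H.pow_mem (sq_mem_of_index_two hH g) k
    rw [pow_succ, pow_mul] at h
    rw [eq_inv_of_mul_eq_one_right h]
    exact H.inv_mem h2

theorem existsUnique_index_eq_two (hn : Odd n) (hcard : Nat.card G = 2 * n) :
    ∃! H : Subgroup G, H.index = 2 := by
  refine existsUnique_of_exists_of_unique ?_ fun H K hH hK => ?_
  · have := Fact.mk Nat.prime_two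
    obtain ⟨P⟩ : Nonempty (Sylow 2 G) := inferInstance
    have hP := card_sylow_two hn hcard P
    have hcyc : IsCyclic P := isCyclic_of_prime_card hP
    have hmin : (Nat.card G).minFac = 2 := by
      rw [Nat.minFac_eq_two_iff, hcard]
      exact dvd_mul_right 2 n
    -- A cyclic Sylow subgroup for the smallest prime divisor has a normal complement, by Burnside's
    -- transfer theorem.
    exact ⟨_, (hcyc.isComplement' hmin).symm.index_eq_card.trans hP⟩
  · ext g
    rw [mem_iff_pow_eq_one_of_index_two hn hcard hH, mem_iff_pow_eq_one_of_index_two hn hcard hK]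

end Subgroup

/-! ### Groups in which every element of even order is an involution -/

section

variable {G : Type*} [Group G] {n : ℕ}

theorem sq_eq_one_of_notMem (hn : Odd n) (hcard : Nat.card G = 2 * n)
    (hinv : ∀ g : G, Even (orderOf g) → orderOf g = 2) {H : Subgroup G} (hH : H.index = 2)
    {t : G} (ht : t ∉ H) : t ^ 2 = 1 := by
  rw [H.mem_iff_pow_eq_one_of_index_two hn hcard hH, ← orderOf_dvd_iff_pow_eq_one] at ht
  have hev : Even (orderOf t) := by
    by_contra h
    have hcop : Nat.Coprime (orderOf t) 2 := (Nat.not_even_iff_odd.1 h).coprime_two_right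
    exact ht (hcop.dvd_of_dvd_mul_left (hcard ▸ orderOf_dvd_natCard t))
  rw [← hinv t hev, pow_orderOf_eq_one]

theorem mul_comm_of_index_two (hn : Odd n) (hcard : Nat.card G = 2 * n)
    (hinv : ∀ g : G, Even (orderOf g) → orderOf g = 2) {H : Subgroup G} (hH : H.index = 2)
    (x y : H) : x * y = y * x := by
  obtain ⟨t, ht⟩ : ∃ t, t ∉ H := by
    by_contra! h
    rw [(Subgroup.eq_top_iff' H).2 h, Subgroup.index_top] at hH
    omega
  have ht2 : t * t = 1 := by rw [← sq, sq_eq_one_of_notMem hn hcard hinv hH ht]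
  -- Both `t` and `t * h` lie outside `H`, so both square to `1`. Conjugation by `t` is thus
  -- inversion on `H`, and inversion is a homomorphism only on an abelian group.
  have conj : ∀ h ∈ H, t * h * t⁻¹ = h⁻¹ := fun h hh => by
    have h1 := sq_eq_one_of_notMem hn hcard hinv hH (t := t * h)
      (fun h' => ht ((H.mul_mem_cancel_right hh).1 h'))
    rw [sq, ← mul_assoc] at h1
    rw [inv_eq_of_mul_eq_one_left ht2]
    exact eq_inv_of_mul_eq_one_left h1
  have hxy := conj _ (H.mul_mem x.2 y.2)
  have hprod : t * (x * y : G) * t⁻¹ = (t * x * t⁻¹) * (t * y * t⁻¹) := by group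
  rw [hprod, conj _ x.2, conj _ y.2, ← mul_inv_rev] at hxy
  exact Subtype.ext (inv_injective hxy).symm

theorem powEqOne_two_eq (hn : Odd n) (hcard : Nat.card G = 2 * n)
    (hinv : ∀ g : G, Even (orderOf g) → orderOf g = 2) {H : Subgroup G} (hH : H.index = 2) :
    powEqOne G 2 = insert 1 (H : Set G)ᶜ := by
  ext g
  simp only [powEqOne, Set.mem_ofPred_eq, Set.mem_insert_iff, Set.mem_compl_iff, SetLike.mem_coe]
  refine ⟨fun h => ?_, ?_⟩
  · by_cases hg : g ∈ H
    · rw [H.mem_iff_pow_eq_one_of_index_two hn hcard hH] at hg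
      obtain ⟨k, rfl⟩ := hn
      rw [pow_succ, pow_mul, h, one_pow, one_mul] at hg
      exact Or.inl hg
    · exact Or.inr hg
  · rintro (rfl | h)
    · exact one_pow 2
    · exact sq_eq_one_of_notMem hn hcard hinv hH h

variable [Finite G]

theorem ncard_compl_of_index_two (hcard : Nat.card G = 2 * n) {H : Subgroup G}
    (hH : H.index = 2) : ((H : Set G)ᶜ).ncard = n := by
  have h1 := Set.ncard_add_ncard_compl (H : Set G)
  have h2 : (H : Set G).ncard = n := Subgroup.card_of_index_two hcard hH
  omega

theorem ncard_powEqOne_two (hn : Odd n) (hcard : Nat.card G = 2 * n)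
    (hinv : ∀ g : G, Even (orderOf g) → orderOf g = 2) {H : Subgroup G} (hH : H.index = 2) :
    (powEqOne G 2).ncard = n + 1 := by
  rw [powEqOne_two_eq hn hcard hinv hH, Set.ncard_insert_of_notMem (by simp [H.one_mem]),
    ncard_compl_of_index_two hcard hH]

/-- The upper bound is divisibility by the index of a Sylow 2-subgroup; for the lower bound, each of
the `n` involutions outside `H` generates its own Sylow subgroup. -/
theorem numSylowTwo_eq (hn : Odd n) (hcard : Nat.card G = 2 * n)
    (hinv : ∀ g : G, Even (orderOf g) → orderOf g = 2) {H : Subgroup G} (hH : H.index = 2) :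
    numSylowTwo G = n := by
  have := Fact.mk Nat.prime_two
  classical
  obtain ⟨P⟩ : Nonempty (Sylow 2 G) := inferInstance
  have hP := Subgroup.card_sylow_two hn hcard P
  refine le_antisymm (Nat.le_of_dvd hn.pos ?_) ?_
  · have h1 := P.card_dvd_index
    have h2 := P.toSubgroup.card_mul_index
    rw [hcard, hP] at h2
    rwa [Nat.eq_of_mul_eq_mul_left two_pos h2] at h1
  · have hord : ∀ t : ((H : Set G)ᶜ : Set G), orderOf (t : G) = 2 := fun t =>
      orderOf_eq_prime (sq_eq_one_of_notMem hn hcard hinv hH t.2)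
        fun h => t.2 (h ▸ H.one_mem)
    let f : ((H : Set G)ᶜ : Set G) → Sylow 2 G := fun t =>
      Sylow.ofCard (Subgroup.zpowers (t : G)) (by
        rw [← P.card_eq_multiplicity, hP, Nat.card_zpowers, hord t])
    have hf : Function.Injective f := fun s t hst => by
      have hz : Subgroup.zpowers (s : G) = Subgroup.zpowers (t : G) :=
        congrArg Sylow.toSubgroup hst
      have hs : (s : G) ∈ Subgroup.zpowers (t : G) := hz ▸ Subgroup.mem_zpowers _
      rw [mem_zpowers_iff_mem_range_orderOf, hord t] at hs
      simp only [Finset.mem_image, Finset.mem_range] at hs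
      obtain ⟨k, hk, hks⟩ := hs
      interval_cases k
      · exact absurd (hks ▸ (pow_zero (t : G)).symm ▸ H.one_mem) s.2
      · exact Subtype.ext (by rw [← hks, pow_one])
    have := Nat.card_le_card_of_injective f hf
    rwa [Nat.card_coe_set_eq, ncard_compl_of_index_two hcard hH] at this

theorem dG_eq (hn : Odd n) (hcard : Nat.card G = 2 * n)
    (hinv : ∀ g : G, Even (orderOf g) → orderOf g = 2) {H : Subgroup G} (hH : H.index = 2) :
    dG G = (-1) ^ ((n - 1) / 2) * n * (2 ^ ((n + 1) / 2) * n ^ ((n - 1) / 2)) ^ 2 := by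
  have hS := numSylowTwo_eq hn hcard hinv hH
  have hε : epsG G = 1 := if_pos (by rw [hS, hcard])
  -- Dividing by `n₂(G) = n` leaves `2 ^ (n + 1) * n ^ n`, whose exponents are even and odd
  -- respectively, so its squarefree class is that of `n`.
  have hdiv : (2 * n) ^ (n + 1) / n ^ 1 =
      n * (2 ^ ((n + 1) / 2) * n ^ ((n - 1) / 2)) ^ 2 := by
    refine Nat.div_eq_of_eq_mul_left (pow_pos hn.pos 1) ?_
    obtain ⟨k, rfl⟩ := hn
    have h1 : (2 * k + 1 + 1) / 2 = k + 1 := by omega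
    have h2 : (2 * k + 1 - 1) / 2 = k := by omega
    rw [h1, h2, mul_pow 2]
    ring
  rw [dG, hS, hε, hcard, ncard_powEqOne_two hn hcard hinv hH, hdiv,
    show 2 * n - (n + 1) = n - 1 by omega]
  push_cast
  ring

theorem elSign_eq_of_index_two (hn : Odd n) (hcard : Nat.card G = 2 * n)
    (hinv : ∀ g : G, Even (orderOf g) → orderOf g = 2) {H : Subgroup G} (hH : H.index = 2)
    {a : ℤ} (ha : IsCoprime a (Nat.card G : ℤ)) :
    elSign G a ha = elSign H a (ha.card_subgroup H) := by
  classical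
  let := Fintype.ofFinite G
  have hodd : Odd a := by
    rw [← Int.not_even_iff_odd, even_iff_two_dvd]
    intro h
    rw [hcard] at ha
    push_cast at ha
    exact absurd (ha.of_mul_right_left.isUnit_of_dvd' h dvd_rfl) (by decide)
  have hfix : ∀ t, t ∉ H → t ^ a = t := fun t ht => by
    obtain ⟨k, rfl⟩ := hodd
    rw [zpow_add, zpow_mul, zpow_ofNat, sq_eq_one_of_notMem hn hcard hinv hH ht, one_zpow,
      one_mul, zpow_one]
  have hmem : ∀ x, powerPerm G a ha x ∈ H ↔ x ∈ H := fun x => by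
    refine ⟨fun h => ?_, fun h => H.zpow_mem h a⟩
    by_contra hx
    exact hx (hfix x hx ▸ h)
  rw [elSign_eq_sign_of_equiv (ha.card_subgroup H) (Equiv.refl H)
      ((powerPerm G a ha).subtypePerm hmem) fun _ => rfl,
    Equiv.Perm.sign_subtypePerm _ _ fun x hx => by
      by_contra h
      exact hx (hfix x h),
    elSign_eq_sign_of_equiv ha (Equiv.refl G) (powerPerm G a ha) fun _ => rfl]

end

theorem mainTheorem7 {G : Type*} [Group G] [Finite G] (n : ℕ) (hn : Odd n)
    (hcard : Nat.card G = 2 * n)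
    (hinv : ∀ g : G, Even (orderOf g) → orderOf g = 2) :
    (∀ (a : ℤ) (ha : IsCoprime a (Nat.card G : ℤ)),
      ((elSign G a ha : ℤˣ) : ℤ) = kroneckerSym (dG G) a) ∧
    (∃! H : Subgroup G, H.index = 2) ∧
    ∀ H : Subgroup G, H.index = 2 → Nat.card H = n ∧
      ∀ (a : ℤ) (ha : IsCoprime a (Nat.card G : ℤ)),
        elSign G a ha = elSign H a (ha.card_subgroup H) := by
  have hex := Subgroup.existsUnique_index_eq_two hn hcard
  refine ⟨fun a ha => ?_, hex, fun H hH => ⟨H.card_of_index_two hcard hH,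
    fun a ha => elSign_eq_of_index_two hn hcard hinv hH ha⟩⟩
  obtain ⟨H, hH, -⟩ := hex
  have hHn := H.card_of_index_two hcard hH
  -- This extends the existing group structure on `H`, so `elSign H` keeps its meaning.
  let : CommGroup H := { mul_comm := mul_comm_of_index_two hn hcard hinv hH }
  have ha2n : IsCoprime a (2 * n) := by
    rw [hcard] at ha
    exact_mod_cast ha
  have hn0 : (n : ℤ) ≠ 0 := by exact_mod_cast hn.pos.ne'
  rw [elSign_eq_of_index_two hn hcard hinv hH ha,
    kroneckerSym_eq_jacobiSym hn ha2n ?_ ?_ (dG_eq hn hcard hinv hH), ← hHn]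
  · exact elSign_of_odd_comm (hHn ▸ hn) (ha.card_subgroup H)
  · exact (ha2n.of_mul_right_left.pow_right).mul_right (ha2n.of_mul_right_right.pow_right)
  · positivity
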